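/- Let $\beta$ be a Pisot or a Salem number, that is, a real algebraic integer $\beta>1$ whose other complex conjugates all lie in the open unit disc (Pisot), or all lie in the closed unit disc with at least one of them on the unit circle (Salem). Then the $\beta$-expansion of a Liouville number cannot be generated by a finite automaton. Precisely, let $T(x)=\beta x-\lfloor \beta x\rfloor$, and for $x\in[0,1)$ let $d_n(x)=\lfloor \beta\, T^{n-1}(x)\rfloor$ $(n\ge 1)$ be the digits of the Rényi $\beta$-expansion $x=\sum_{n\ge 1} d_n(x)\beta^{-n}$. Let $\xi$ be a Liouville number, i.e. a real number such that for every $N\ge 0$ there are integers $p,q$ with $q>1$ and $0<|\xi-p/q|<q^{-N}$. Then: 1. the Rényi $\beta$-expansion $a_0.a_1a_2\ldots$ of $\xi$, given by $a_0=\lfloor\xi\rfloor$ and $a_n=d_n(\xi-\lfloor\xi\rfloor)$ for $n\ge1$, is such that $(a_n)_{n\ge 0}$ is not generated by a finite automaton; 2. if $\xi\ge0$ and $m\ge 0$ is an integer with $\xi<\beta^m$, the sequence of digits of the greedy expansion $\xi=\sum_{n\ge1} d_n(\xi/\beta^m)\,\beta^{m-n}$ is not generated by a finite automaton either. Here a sequence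 $(a_n)_{n\ge0}$ is generated by a finite automaton if, for some integer $k\ge2$, there is a deterministic finite automaton with output on the input alphabet $\{0,\ldots,k-1\}$ which, for every $n\ge 0$, outputs $a_n$ after reading the base-$k$ expansion of $n$, starting with the least significant digit. A sequence indexed from $1$ is re-indexed from $0$. -/

import Mathlib

/-- A Pisot number: a real algebraic integer `β > 1` all of whose other complex conjugates lie in
the open unit disc. (The integers `≥ 2` are Pisot numbers.) -/
def IsPisot (β : ℝ) : Prop :=
  IsIntegral ℤ β ∧ 1 < β ∧
    ∀ z : ℂ, Polynomial.aeval z (minpoly ℚ β) = 0 → z ≠ (β : ℂ) → ‖z‖ < 1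

/-- A Salem number: a real algebraic integer `β > 1` all of whose other complex conjugates lie in
the closed unit disc, at least one of them being on the unit circle. -/
def IsSalem (β : ℝ) : Prop :=
  IsIntegral ℤ β ∧ 1 < β ∧
    (∀ z : ℂ, Polynomial.aeval z (minpoly ℚ β) = 0 → z ≠ (β : ℂ) → ‖z‖ ≤ 1) ∧
    ∃ z : ℂ, Polynomial.aeval z (minpoly ℚ β) = 0 ∧ ‖z‖ = 1

/-- The `β`-transformation `x ↦ βx mod 1`. -/
noncomputable def betaMap (β x : ℝ) : ℝ := Int.fract (β * x)

/-- The digits of the Rényi `β`-expansion of `x ∈ [0, 1)`: the entry with index `n` is the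
coefficient `⌊β Tⁿ x⌋` of `β ^ (-(n + 1))`, where `T` is the `β`-transformation. -/
noncomputable def betaDigits (β x : ℝ) (n : ℕ) : ℤ := ⌊β * (betaMap β)^[n] x⌋

/-- The Rényi `β`-expansion `a₀ . a₁ a₂ a₃ …` of an arbitrary real number `x`:
`a₀ = ⌊x⌋`, and `a₁ a₂ a₃ …` are the digits of the fractional part of `x`. -/
noncomputable def renyiExpansion (β x : ℝ) : ℕ → ℤ
  | 0 => ⌊x⌋
  | n + 1 => betaDigits β (Int.fract x) n

/-- A deterministic finite automaton with output, reading words on the alphabet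
`{0, 1, …, k - 1}` and with values in `Δ`. -/
structure FiniteAutomaton (k : ℕ) (Δ : Type) where
  /-- The states. -/
  State : Type
  /-- There are finitely many states. -/
  finite_state : Finite State
  /-- The transition function. -/
  step : State → Fin k → State
  /-- The initial state. -/
  start : State
  /-- The output function. -/
  output : State → Δ

/-- The value produced by the automaton after it has read a word from left to right. -/
def FiniteAutomaton.run {k : ℕ} {Δ : Type} (A : FiniteAutomaton k Δ) (w : List (Fin k)) : Δ :=
  A.output (w.foldl A.step A.start)

/-- The word `w₀ w₁ … w_r` where `w_r … w₁ w₀` is the `k`-ary expansion of `n`; the expansion of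
`0` is the one-letter word `0`. -/
def baseWord (k : ℕ) (hk : 2 ≤ k) (n : ℕ) : List (Fin k) :=
  if n = 0 then [⟨0, by omega⟩]
  else (Nat.digits k n).pmap Fin.mk (fun _ hd => Nat.digits_lt_base (by omega) hd)

/-- `a` is generated by a finite automaton: for some `k ≥ 2` there is a finite automaton which,
for every `n`, produces `a n` when fed with the `k`-ary expansion of `n`. -/
def IsAutomatic {Δ : Type} (a : ℕ → Δ) : Prop :=
  ∃ (k : ℕ) (hk : 2 ≤ k) (A : FiniteAutomaton k Δ), ∀ n : ℕ, a n = A.run (baseWord k hk n)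

/-! Finitely many states force repetitions: for every n two blocks of length ℓ = k^n, at positions
O(ℓ), coincide in the digit sequence (`IsAutomatic.exists_repetition`). Two orbit points T^r y,
T^(r+s) y then differ by θ with |θ| ≤ β^(-ℓ); also |θ| ≥ β^(-Cℓ), the orbit being injective because
ξ is transcendental (`exists_repetition_bounds`). Replacing ξ by P/Q and dropping θ gives an integer
polynomial G with G(β) = W - Q D(β) θ, where W is a multiple of Qξ - P. The other conjugates of β
lie in the closed disc, so those of G(β) are only O(Qℓ), and by `one_le_abs_aeval_mul_pow` G(β) is
zero or at least a power of 1/(Qℓ). With β^ℓ of polynomial size in Q (`exists_scale`), W is bounded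
below by a power of 1/Q in both cases. Hence ξ is not Liouville. -/

/-! ### Orbits and digits of the β-transformation. -/

section BetaDynamics

variable {β : ℝ}

theorem betaMap_iterate_mem {x : ℝ} (hx : x ∈ Set.Ico (0 : ℝ) 1) (n : ℕ) :
    (betaMap β)^[n] x ∈ Set.Ico (0 : ℝ) 1 := by
  cases n with
  | zero => simpa using hx
  | succ n =>
    rw [Function.iterate_succ_apply']
    exact ⟨Int.fract_nonneg _, Int.fract_lt_one _⟩

theorem betaDigits_add (x : ℝ) (m n : ℕ) :
    betaDigits β ((betaMap β)^[m] x) n = betaDigits β x (m + n) := by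
  simp only [betaDigits]
  rw [← Function.iterate_add_apply, add_comm]

theorem beta_mul_iterate (x : ℝ) (n : ℕ) :
    β * (betaMap β)^[n] x = betaDigits β x n + (betaMap β)^[n + 1] x := by
  rw [Function.iterate_succ_apply']
  exact (Int.floor_add_fract _).symm

theorem betaDigits_nonneg (hβ : 1 < β) {x : ℝ} (hx : x ∈ Set.Ico (0 : ℝ) 1) (n : ℕ) :
    0 ≤ betaDigits β x n :=
  Int.floor_nonneg.2 (mul_nonneg (by linarith) (betaMap_iterate_mem hx n).1)

theorem betaDigits_le (hβ : 1 < β) {x : ℝ} (hx : x ∈ Set.Ico (0 : ℝ) 1) (n : ℕ) :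
    (betaDigits β x n : ℝ) ≤ β := by
  have h := betaMap_iterate_mem (β := β) hx n
  refine (Int.floor_le _).trans ?_
  nlinarith [h.1, h.2]

/-- The polynomial `a₀ X ^ (n - 1) + a₁ X ^ (n - 2) + ⋯ + a_{n - 1}`. -/
noncomputable def hornerPoly (a : ℕ → ℤ) : ℕ → Polynomial ℤ
  | 0 => 0
  | n + 1 => Polynomial.X * hornerPoly a n + Polynomial.C (a n)

theorem pow_mul_eq_aeval_hornerPoly (x : ℝ) (n : ℕ) :
    β ^ n * x = Polynomial.aeval β (hornerPoly (betaDigits β x) n) + (betaMap β)^[n] x := by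
  induction n with
  | zero => simp [hornerPoly]
  | succ n ih =>
    have h := beta_mul_iterate (β := β) x n
    simp only [hornerPoly, map_add, map_mul, Polynomial.aeval_X, Polynomial.aeval_C]
    rw [pow_succ', mul_assoc, ih, mul_add, h]
    simp
    ring

theorem norm_aeval_hornerPoly_le {a : ℕ → ℤ} {b : ℝ} (ha : ∀ n, |(a n : ℝ)| ≤ b) {z : ℂ}
    (hz : ‖z‖ ≤ 1) (n : ℕ) : ‖Polynomial.aeval z (hornerPoly a n)‖ ≤ n * b := by
  induction n with
  | zero => simp [hornerPoly]
  | succ n ih =>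
    simp only [hornerPoly, map_add, map_mul, Polynomial.aeval_X, Polynomial.aeval_C]
    refine (norm_add_le _ _).trans ?_
    have h1 : ‖(algebraMap ℤ ℂ) (a n)‖ ≤ b := by simpa using ha n
    have h2 : ‖z * Polynomial.aeval z (hornerPoly a n)‖ ≤ n * b := by
      rw [norm_mul]
      exact (mul_le_of_le_one_left (norm_nonneg _) hz).trans ih
    push_cast
    linarith

theorem pow_mul_sub_eq_of_digits_eq {x x' : ℝ} {n : ℕ}
    (h : ∀ i < n, betaDigits β x i = betaDigits β x' i) :
    β ^ n * (x - x') = (betaMap β)^[n] x - (betaMap β)^[n] x' := by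
  induction n with
  | zero => simp
  | succ n ih =>
    have h1 := beta_mul_iterate (β := β) x n
    have h2 := beta_mul_iterate (β := β) x' n
    have h3 := ih fun i hi => h i (by omega)
    rw [h n (by omega)] at h1
    rw [pow_succ', mul_assoc, h3, mul_sub, h1, h2]
    ring

theorem abs_sub_le_of_digits_eq (hβ : 1 < β) {x x' : ℝ} (hx : x ∈ Set.Ico (0 : ℝ) 1)
    (hx' : x' ∈ Set.Ico (0 : ℝ) 1) {n : ℕ}
    (h : ∀ i < n, betaDigits β x i = betaDigits β x' i) :
    β ^ n * |x - x'| ≤ 1 := by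
  have hp : 0 < β ^ n := by positivity
  rw [← abs_of_pos hp, ← abs_mul, pow_mul_sub_eq_of_digits_eq h, abs_le]
  have h1 := betaMap_iterate_mem (β := β) hx n
  have h2 := betaMap_iterate_mem (β := β) hx' n
  constructor <;> linarith [h1.1, h1.2, h2.1, h2.2]

theorem exists_betaDigits_ne (hβ : 1 < β) {x x' : ℝ} (hx : x ∈ Set.Ico (0 : ℝ) 1)
    (hx' : x' ∈ Set.Ico (0 : ℝ) 1) (hne : x ≠ x') :
    ∃ i, betaDigits β x i ≠ betaDigits β x' i := by
  by_contra! h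
  have hpos : 0 < |x - x'| := abs_pos.2 (sub_ne_zero.2 hne)
  obtain ⟨n, hn⟩ := pow_unbounded_of_one_lt (1 / |x - x'|) hβ
  rw [div_lt_iff₀ hpos] at hn
  linarith [abs_sub_le_of_digits_eq hβ hx hx' (n := n) fun i _ => h i]

theorem one_le_pow_mul_of_digit_ne_zero (hβ : 1 < β) {x : ℝ} (hx : x ∈ Set.Ico (0 : ℝ) 1) {n : ℕ}
    (h : betaDigits β x n ≠ 0) : 1 ≤ β ^ (n + 1) * x := by
  have h0 : ∀ m, (betaMap β)^[m] x ≤ β ^ m * x := by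
    intro m
    induction m with
    | zero => simp
    | succ m ih =>
      have h1 := beta_mul_iterate (β := β) x m
      have h2 : (0 : ℝ) ≤ betaDigits β x m := by exact_mod_cast betaDigits_nonneg hβ hx m
      rw [pow_succ', mul_assoc]
      nlinarith
  have h1 := beta_mul_iterate (β := β) x n
  have h2 : (1 : ℝ) ≤ betaDigits β x n := by
    have := betaDigits_nonneg hβ hx n
    exact_mod_cast (show 1 ≤ betaDigits β x n by omega)
  have h3 := (betaMap_iterate_mem (β := β) hx (n + 1)).1
  have h4 := h0 n
  rw [pow_succ', mul_assoc]
  nlinarith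

/-- At the first disagreement the digits differ by at least 1, which outweighs the tail of x' (below
1); the tail of x is what remains. -/
theorem iterate_le_pow_mul_sub {x x' : ℝ} (hx' : x' ∈ Set.Ico (0 : ℝ) 1) {n : ℕ}
    (h : ∀ i < n, betaDigits β x i = betaDigits β x' i)
    (hlt : betaDigits β x' n < betaDigits β x n) :
    (betaMap β)^[n + 1] x ≤ β ^ (n + 1) * (x - x') := by
  have h1 := beta_mul_iterate (β := β) x n
  have h2 := beta_mul_iterate (β := β) x' n
  have h3 : (betaDigits β x' n : ℝ) + 1 ≤ betaDigits β x n := by exact_mod_cast hlt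
  rw [pow_succ', mul_assoc, pow_mul_sub_eq_of_digits_eq h, mul_sub, h1, h2]
  linarith [(betaMap_iterate_mem (β := β) hx' (n + 1)).2]

theorem betaMap_iterate_ne_zero {x : ℝ} (hinj : Function.Injective fun n => (betaMap β)^[n] x)
    (n : ℕ) : (betaMap β)^[n] x ≠ 0 := by
  intro h
  have h1 : (betaMap β)^[n + 1] x = (betaMap β)^[n] x := by
    rw [Function.iterate_succ_apply', h]
    simp [betaMap]
  have := hinj h1
  omega

theorem exists_betaDigits_ne_zero (hβ : 1 < β) {x : ℝ} (hx : x ∈ Set.Ico (0 : ℝ) 1)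
    (hinj : Function.Injective fun n => (betaMap β)^[n] x) (n : ℕ) :
    ∃ i ≥ n, betaDigits β x i ≠ 0 := by
  have hm := betaMap_iterate_mem (β := β) hx n
  obtain ⟨i, hi⟩ := exists_betaDigits_ne hβ hm (x' := 0) (by simp)
    (betaMap_iterate_ne_zero hinj n)
  have h0 : betaDigits β 0 i = 0 := by
    have : (betaMap β)^[i] 0 = 0 := Function.iterate_fixed (by simp [betaMap]) i
    simp [betaDigits, this]
  rw [h0, betaDigits_add] at hi
  exact ⟨n + i, by omega, hi⟩

end BetaDynamics

/-! ### Automatic sequences. -/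

theorem exists_uniform_bound {S : Type} [Finite S] (P : S → ℕ → Prop) :
    ∃ C : ℕ, ∀ s, (∃ j, P s j) → ∃ j < C, P s j := by
  classical
  have : Fintype S := Fintype.ofFinite S
  refine ⟨(Finset.univ.sup fun s => if h : ∃ j, P s j then Nat.find h else 0) + 1, fun s hs => ?_⟩
  refine ⟨Nat.find hs, ?_, Nat.find_spec hs⟩
  have := Finset.le_sup (f := fun s => if h : ∃ j, P s j then Nat.find h else 0)
    (Finset.mem_univ s)
  simp only [hs, dif_pos] at this
  omega

/-- The states reached from `s` on reading the digits of `j`, least significant digit first. -/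
theorem IsAutomatic.exists_kernel {Δ : Type} {a : ℕ → Δ} (ha : IsAutomatic a) :
    ∃ (k : ℕ) (S : Type) (out : S → Δ) (g : S → ℕ → S) (q : ℕ → ℕ → S), 2 ≤ k ∧ Finite S ∧
      ∀ n l j, l < k ^ n → 1 ≤ j → a (j * k ^ n + l) = out (g (q n l) j) := by
  obtain ⟨k, hk, A, hA⟩ := ha
  have hk1 : 1 < k := by omega
  let dig : ℕ → List (Fin k) := fun n =>
    (Nat.digits k n).pmap Fin.mk (fun _ hd => Nat.digits_lt_base hk1 hd)
  let pad : ℕ → ℕ → List (Fin k) := fun n l =>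
    dig l ++ List.replicate (n - (Nat.digits k l).length) ⟨0, by omega⟩
  refine ⟨k, A.State, A.output, fun s j => (dig j).foldl A.step s,
    fun n l => (pad n l).foldl A.step A.start, hk, A.finite_state, fun n l j hl hj => ?_⟩
  have hlen : (Nat.digits k l).length ≤ n := (Nat.digits_length_le_iff hk1 l).2 hl
  have hne : j * k ^ n + l ≠ 0 := by positivity
  -- Low digits come first, so l padded with zeros to length n is read before j; j ≥ 1 makes these
  -- padding zeros actual digits.
  have key : dig (j * k ^ n + l) = pad n l ++ dig j := by
    apply (List.map_injective_iff.2 Fin.val_injective)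
    have hd : ∀ m, (dig m).map Fin.val = Nat.digits k m := by
      intro m
      simp [dig, List.map_pmap]
    rw [List.map_append, hd, hd]
    simp only [pad, List.map_append, hd, List.map_replicate]
    have h := Nat.digits_append_zeroes_append_digits (b := k)
      (k := n - (Nat.digits k l).length) (m := j) (n := l) hk1 hj
    rw [h]
    congr 1
    rw [Nat.add_sub_cancel' hlen]
    ring
  rw [hA, FiniteAutomaton.run, baseWord, if_neg hne]
  change A.output ((dig (j * k ^ n + l)).foldl A.step A.start) = _
  rw [key, List.foldl_append]

/-- Repetitions in automatic sequences, together with linear bounds for the place where they end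
and for the runs of a given value. -/
theorem IsAutomatic.exists_repetition {Δ : Type} {a : ℕ → Δ} (ha : IsAutomatic a) (c : Δ) :
    ∃ k j p C : ℕ, 2 ≤ k ∧ 1 ≤ j ∧ 1 ≤ p ∧
      (∀ n, ∀ l < k ^ n, a (j * k ^ n + l) = a ((j + p) * k ^ n + l)) ∧
      (∀ n, (∃ i ≥ j * k ^ n, a (i + p * k ^ n) ≠ a i) →
        ∃ i ≥ j * k ^ n, i < C * k ^ n ∧ a (i + p * k ^ n) ≠ a i) ∧
      ((∀ N, ∃ i ≥ N, a i ≠ c) → ∀ N, 1 ≤ N → ∃ i ≥ N, i < C * N ∧ a i ≠ c) := by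
  obtain ⟨k, S, out, g, q, hk, hS, hq⟩ := ha.exists_kernel
  -- Pigeonhole on the finitely many maps S → S: the same j and p serve all n and l.
  obtain ⟨j, p, hj, hp, hjp⟩ : ∃ j p, 1 ≤ j ∧ 1 ≤ p ∧ ∀ s, g s j = g s (j + p) := by
    obtain ⟨x, y, hxy, h⟩ :=
      Finite.exists_ne_map_eq_of_infinite fun (j : ℕ) (s : S) => g s (j + 1)
    wlog hlt : x < y generalizing x y
    · exact this y x hxy.symm h.symm (by omega)
    refine ⟨x + 1, y - x, by omega, by omega, fun s => ?_⟩
    rw [show x + 1 + (y - x) = y + 1 by omega]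
    exact congrFun h s
  obtain ⟨C₁, hC₁⟩ := exists_uniform_bound
    fun (s : S) i => j ≤ i ∧ out (g s (i + p)) ≠ out (g s i)
  obtain ⟨C₂, hC₂⟩ := exists_uniform_bound fun (s : S) i => k ≤ i ∧ out (g s i) ≠ c
  have hpos : ∀ n, 0 < k ^ n := fun n => by positivity
  have hshift : ∀ n i l, (i * k ^ n + l) + p * k ^ n = (i + p) * k ^ n + l := fun n i l => by ring
  have hmono : ∀ {D i n l : ℕ}, i < D → l < k ^ n → i * k ^ n + l < D * k ^ n := by
    intro D i n l hi hl
    calc i * k ^ n + l < (i + 1) * k ^ n := by rw [add_mul]; omega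
      _ ≤ D * k ^ n := Nat.mul_le_mul_right _ hi
  refine ⟨k, j, p, max C₁ C₂, hk, hj, hp, fun n l hl => ?_, ?_, ?_⟩
  · rw [hq n l _ hl hj, hq n l _ hl (by omega), hjp]
  · rintro n ⟨i, hi, hne⟩
    have hl := Nat.mod_lt i (hpos n)
    have hji : j ≤ i / k ^ n := (Nat.le_div_iff_mul_le (hpos n)).2 hi
    rw [← Nat.div_add_mod' i (k ^ n), hshift, hq n _ _ hl (by omega), hq n _ _ hl (by omega)] at hne
    obtain ⟨i', hi', hji', hne'⟩ := hC₁ (q n (i % k ^ n)) ⟨_, hji, hne⟩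
    refine ⟨i' * k ^ n + i % k ^ n, ?_, ?_, ?_⟩
    · exact (Nat.mul_le_mul_right _ hji').trans (Nat.le_add_right _ _)
    · exact (hmono hi' hl).trans_le (Nat.mul_le_mul_right _ (le_max_left _ _))
    · rwa [hshift, hq n _ _ hl (by omega), hq n _ _ hl (by omega)]
  · intro hinf N hN
    set n := Nat.log k N
    have h1 : k ^ n ≤ N := Nat.pow_log_le_self k (by omega)
    have h2 : N < k ^ (n + 1) := Nat.lt_pow_succ_log_self (by omega) N
    obtain ⟨i, hi, hne⟩ := hinf (k ^ (n + 1))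
    have hl := Nat.mod_lt i (hpos n)
    have hji : k ≤ i / k ^ n := (Nat.le_div_iff_mul_le (hpos n)).2 (by rw [← pow_succ']; exact hi)
    rw [← Nat.div_add_mod' i (k ^ n), hq n _ _ hl (by omega)] at hne
    obtain ⟨i', hi', hji', hne'⟩ := hC₂ (q n (i % k ^ n)) ⟨_, hji, hne⟩
    refine ⟨i' * k ^ n + i % k ^ n, ?_, ?_, ?_⟩
    · have := Nat.mul_le_mul_right (k ^ n) hji'
      rw [← pow_succ'] at this
      exact (h2.le.trans this).trans (Nat.le_add_right _ _)
    · exact (hmono hi' hl).trans_le (Nat.mul_le_mul (le_max_right _ _) h1)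
    · rwa [hq n _ _ hl (by omega)]

/-! ### Diophantine and growth estimates. -/

open Polynomial IntermediateField in
/-- Liouville's inequality: a nonzero algebraic integer cannot be small unless one of its
conjugates is large. -/
theorem one_le_abs_aeval_mul_pow {β : ℝ} (hβ : IsIntegral ℤ β) : ∃ d : ℕ, ∀ (G : ℤ[X]) (M : ℝ),
    1 ≤ M → aeval β G ≠ 0 →
    (∀ z : ℂ, aeval z (minpoly ℚ β) = 0 → z ≠ (β : ℂ) → ‖aeval z G‖ ≤ M) →
    1 ≤ |aeval β G| * M ^ d := by
  have hQ : IsIntegral ℚ β := hβ.tower_top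
  have : FiniteDimensional ℚ ℚ⟮β⟯ := adjoin.finiteDimensional hQ
  have hgen : ∀ σ : ℚ⟮β⟯ →ₐ[ℚ] ℂ, aeval (σ (AdjoinSimple.gen ℚ β)) (minpoly ℚ β) = 0 := by
    intro σ
    rw [aeval_algHom_apply]
    have : aeval (AdjoinSimple.gen ℚ β) (minpoly ℚ β) = 0 := by
      rw [← minpoly_gen ℚ β]
      exact minpoly.aeval _ _
    rw [this, map_zero]
  classical
  let ι : ℚ⟮β⟯ →ₐ[ℚ] ℂ := (Complex.ofRealAm.restrictScalars ℚ).comp (val ℚ⟮β⟯)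
  refine ⟨(Finset.univ.erase ι).card, fun G M hM hG hz => ?_⟩
  set w : ℚ⟮β⟯ := aeval (AdjoinSimple.gen ℚ β) G with hw
  have hval : ((w : ℚ⟮β⟯) : ℝ) = aeval β G := by
    have := aeval_algHom_apply ((val ℚ⟮β⟯).restrictScalars ℤ) (AdjoinSimple.gen ℚ β) G
    simpa using this.symm
  have hw0 : w ≠ 0 := by
    intro h
    rw [h] at hval
    exact hG hval.symm
  have hgenint : IsIntegral ℤ (AdjoinSimple.gen ℚ β) := by
    rw [← isIntegral_algHom_iff ((val ℚ⟮β⟯).restrictScalars ℤ) (val ℚ⟮β⟯).injective]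
    simpa using hβ
  have hwint : IsIntegral ℤ w := by
    rw [hw, aeval_eq_sum_range]
    exact IsIntegral.sum _ fun i _ => (hgenint.pow i).smul _
  -- The norm of w is a nonzero integer; in its product over embeddings, all factors but that of `ι`
  -- are at most M.
  obtain ⟨m, hm⟩ := IsIntegrallyClosed.isIntegral_iff.1 (Algebra.isIntegral_norm ℚ hwint)
  have hm0 : m ≠ 0 := by
    rintro rfl
    rw [map_zero] at hm
    exact hw0 (Algebra.norm_eq_zero_iff.1 hm.symm)
  have hσ : ∀ σ : ℚ⟮β⟯ →ₐ[ℚ] ℂ, σ w = aeval (σ (AdjoinSimple.gen ℚ β)) G := fun σ =>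
    (aeval_algHom_apply (σ.restrictScalars ℤ) (AdjoinSimple.gen ℚ β) G).symm
  have hprod := Algebra.norm_eq_prod_embeddings ℚ ℂ w
  rw [← hm, ← Finset.mul_prod_erase _ _ (Finset.mem_univ ι)] at hprod
  have hnorm := congrArg norm hprod
  rw [norm_mul, norm_prod] at hnorm
  have h1 : (1 : ℝ) ≤ ‖algebraMap ℚ ℂ (algebraMap ℤ ℚ m)‖ := by
    have : (1 : ℝ) ≤ |(m : ℝ)| := by exact_mod_cast Int.one_le_abs hm0
    simpa using this
  have hι : ‖ι w‖ = |aeval β G| := by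
    rw [← hval]
    exact Complex.norm_real _
  rw [hnorm, hι] at h1
  refine h1.trans (mul_le_mul_of_nonneg_left ?_ (abs_nonneg _))
  rw [← Finset.prod_const]
  refine Finset.prod_le_prod (fun _ _ => norm_nonneg _) fun σ hmem => ?_
  rw [hσ]
  refine hz _ (hgen σ) fun h => (Finset.mem_erase.1 hmem).1 ?_
  refine (adjoin.powerBasis hQ).algHom_ext ?_
  rw [adjoin.powerBasis_gen]
  exact h

theorem exists_norm_aeval_le (F : Polynomial ℤ) : ∃ K : ℝ, 0 ≤ K ∧ ∀ z : ℂ, ‖z‖ ≤ 1 →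
    ‖Polynomial.aeval z F‖ ≤ K := by
  refine ⟨∑ i ∈ Finset.range (F.natDegree + 1), ‖(F.coeff i : ℂ)‖, by positivity, fun z hz => ?_⟩
  rw [Polynomial.aeval_eq_sum_range]
  refine (norm_sum_le _ _).trans (Finset.sum_le_sum fun i _ => ?_)
  rw [zsmul_eq_mul, norm_mul, norm_pow]
  exact mul_le_of_le_one_right (norm_nonneg _) (pow_le_one₀ (norm_nonneg _) hz)

theorem exists_mul_pow_le_pow {β : ℝ} (hβ : 1 < β) (M : ℝ) (d : ℕ) :
    ∃ M' : ℝ, 1 ≤ M' ∧ ∀ n : ℕ, M * (n : ℝ) ^ d ≤ M' * β ^ n := by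
  have h := tendsto_pow_const_div_const_pow_of_one_lt d hβ
  obtain ⟨B, hB⟩ := (h.const_mul M).bddAbove_range
  refine ⟨max B 1, le_max_right _ _, fun n => ?_⟩
  have h1 : M * ((n : ℝ) ^ d / β ^ n) ≤ max B 1 := (hB ⟨n, rfl⟩).trans (le_max_left _ _)
  have hp : 0 < β ^ n := by positivity
  rwa [← mul_div_assoc, div_le_iff₀ hp] at h1

theorem exists_scale {β : ℝ} (hβ : 1 < β) {k : ℕ} (hk : 2 ≤ k) (M : ℝ) (hM : 0 ≤ M) (d e : ℕ) :
    ∃ (C : ℝ) (E : ℕ), 1 ≤ C ∧ ∀ Q : ℝ, 1 ≤ Q → ∃ n : ℕ,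
      M * Q ^ e * ((k ^ n : ℕ) : ℝ) ^ d ≤ β ^ (k ^ n) ∧ β ^ (k ^ n) ≤ C * Q ^ E := by
  obtain ⟨M', hM', hb⟩ := exists_mul_pow_le_pow hβ (M ^ 2) (d * 2)
  have hC : 1 ≤ M' ^ k := one_le_pow₀ hM'
  refine ⟨β * M' ^ k, e * 2 * k, by nlinarith, fun Q hQ => ?_⟩
  -- The least such n works: squaring splits β^(2ℓ) between the powers of ℓ and of Q, and minimality
  -- bounds β^(k^(n-1)). The factor β in the constant covers n = 0.
  have hex : ∃ n : ℕ, M' * Q ^ (e * 2) ≤ β ^ (k ^ n) := by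
    obtain ⟨n, hn⟩ := pow_unbounded_of_one_lt (M' * Q ^ (e * 2)) hβ
    exact ⟨n, hn.le.trans (pow_le_pow_right₀ hβ.le (Nat.lt_pow_self (by omega)).le)⟩
  classical
  refine ⟨Nat.find hex, ?_, ?_⟩
  · have h1 := Nat.find_spec hex
    set n := Nat.find hex
    have h2 := hb (k ^ n)
    have hp : 0 ≤ β ^ (k ^ n) := by positivity
    refine (sq_le_sq₀ (by positivity) hp).1 ?_
    calc (M * Q ^ e * ((k ^ n : ℕ) : ℝ) ^ d) ^ 2
        = (M ^ 2 * ((k ^ n : ℕ) : ℝ) ^ (d * 2)) * Q ^ (e * 2) := by ring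
      _ ≤ (M' * β ^ (k ^ n)) * Q ^ (e * 2) := by gcongr
      _ = (M' * Q ^ (e * 2)) * β ^ (k ^ n) := by ring
      _ ≤ β ^ (k ^ n) * β ^ (k ^ n) := by gcongr
      _ = _ := by ring
  · have hX : 1 ≤ M' ^ k * Q ^ (e * 2 * k) := one_le_mul_of_one_le_of_one_le hC (one_le_pow₀ hQ)
    rcases Nat.eq_zero_or_eq_succ_pred (Nat.find hex) with h0 | h0
    · rw [h0, pow_zero, pow_one, mul_assoc]
      nlinarith
    · have h1 := not_le.1 (Nat.find_min hex (m := (Nat.find hex).pred) (by omega))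
      rw [h0, pow_succ, pow_mul]
      calc (β ^ k ^ (Nat.find hex).pred) ^ k ≤ (M' * Q ^ (e * 2)) ^ k := by gcongr
        _ = M' ^ k * Q ^ (e * 2 * k) := by rw [mul_pow, ← pow_mul]
        _ ≤ β * M' ^ k * Q ^ (e * 2 * k) := by
          rw [mul_assoc β]
          exact le_mul_of_one_le_left (zero_le_one.trans hX) hβ.le

/-! ### From automaticity to a Diophantine lower bound. -/

theorem exists_repetition_bounds {β y : ℝ} (hβ : 1 < β) (hy : y ∈ Set.Ico (0 : ℝ) 1) {a : ℕ → ℤ}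
    (ha : IsAutomatic a) (hay : ∀ n, a (n + 1) = betaDigits β y n)
    (hinj : Function.Injective fun n => (betaMap β)^[n] y) :
    ∃ k t C : ℕ, 2 ≤ k ∧ ∀ n, ∃ r s, r + s ≤ t * k ^ n ∧
      β ^ k ^ n * |(betaMap β)^[r + s] y - (betaMap β)^[r] y| ≤ 1 ∧
      1 ≤ β ^ (C * k ^ n) * |(betaMap β)^[r + s] y - (betaMap β)^[r] y| := by
  obtain ⟨k, j, p, C, hk, hj, hp, hrep, hdiff, hrun⟩ := ha.exists_repetition 0
  have hrun' : ∀ N, 1 ≤ N → ∃ i ≥ N, i < C * N ∧ a i ≠ 0 := hrun fun N => by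
    obtain ⟨i, hi, hne⟩ := exists_betaDigits_ne_zero hβ hy hinj N
    exact ⟨i + 1, by omega, by rwa [hay]⟩
  refine ⟨k, j + p, C * (j + p + C), hk, fun n => ?_⟩
  have hpos : 0 < k ^ n := by positivity
  have hjn : 1 ≤ j * k ^ n := Nat.mul_pos hj hpos
  have hpn : 1 ≤ p * k ^ n := Nat.mul_pos hp hpos
  obtain ⟨r, hr⟩ : ∃ r, r + 1 = j * k ^ n := ⟨j * k ^ n - 1, by omega⟩
  set s := p * k ^ n with hs
  have hrs : r + s + 1 = (j + p) * k ^ n := by rw [add_mul]; omega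
  refine ⟨r, s, by omega, ?_, ?_⟩
  · refine abs_sub_le_of_digits_eq hβ (betaMap_iterate_mem hy _) (betaMap_iterate_mem hy _)
      fun i hi => ?_
    rw [betaDigits_add, betaDigits_add, ← hay, ← hay, show r + s + i + 1 = (j + p) * k ^ n + i by
      omega, show r + i + 1 = j * k ^ n + i by omega]
    exact (hrep n i hi).symm
  have hdig : ∀ u i, betaDigits β ((betaMap β)^[u] y) i = a (u + i + 1) := fun u i => by
    rw [betaDigits_add, hay]
  have hex : ∃ i, betaDigits β ((betaMap β)^[r + s] y) i ≠ betaDigits β ((betaMap β)^[r] y) i := by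
    refine exists_betaDigits_ne hβ (betaMap_iterate_mem hy _) (betaMap_iterate_mem hy _) ?_
    intro h
    have := hinj h
    omega
  obtain ⟨h, hh, hne, hlt⟩ : ∃ h, h < C * k ^ n ∧
      betaDigits β ((betaMap β)^[r + s] y) h ≠ betaDigits β ((betaMap β)^[r] y) h ∧
      ∀ i < h, betaDigits β ((betaMap β)^[r + s] y) i = betaDigits β ((betaMap β)^[r] y) i := by
    classical
    refine ⟨Nat.find hex, ?_, Nat.find_spec hex, fun i hi => not_not.1 (Nat.find_min hex hi)⟩
    have ⟨i, hi⟩ := hex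
    rw [hdig, hdig] at hi
    obtain ⟨I, hI, hIC, hIne⟩ := hdiff n ⟨r + i + 1, by omega, by
      rwa [show r + i + 1 + s = r + s + i + 1 by omega]⟩
    refine (Nat.find_min' hex (m := I - j * k ^ n) ?_).trans_lt (by omega)
    rw [hdig, hdig]
    rwa [show r + s + (I - j * k ^ n) + 1 = I + s by omega,
      show r + (I - j * k ^ n) + 1 = I by omega]
  -- After the first disagreement h, the orbit of the larger point meets a nonzero digit within
  -- linear distance, so its tail is not too small.
  have main : ∀ u v, u ≤ r + s →
      (∀ i < h, betaDigits β ((betaMap β)^[u] y) i = betaDigits β ((betaMap β)^[v] y) i) →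
      betaDigits β ((betaMap β)^[v] y) h < betaDigits β ((betaMap β)^[u] y) h →
      1 ≤ β ^ (C * (j + p + C) * k ^ n) * |(betaMap β)^[u] y - (betaMap β)^[v] y| := by
    intro u v hu heq hgt
    have h1 := iterate_le_pow_mul_sub (betaMap_iterate_mem hy v) heq hgt
    rw [← Function.iterate_add_apply] at h1
    obtain ⟨I, hI, hIC, hIne⟩ := hrun' (h + 1 + u + 1) (by omega)
    have h2 := one_le_pow_mul_of_digit_ne_zero hβ (betaMap_iterate_mem hy (h + 1 + u))
      (n := I - (h + 1 + u + 1)) (by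
        rwa [hdig, show h + 1 + u + (I - (h + 1 + u + 1)) + 1 = I by omega])
    set m := I - (h + 1 + u + 1)
    have hexp : m + 1 + (h + 1) ≤ C * (j + p + C) * k ^ n := by
      have : C * (h + 1 + u + 1) ≤ C * ((j + p + C) * k ^ n) :=
        Nat.mul_le_mul_left _ (by rw [add_mul]; omega)
      rw [← mul_assoc] at this
      omega
    calc 1 ≤ β ^ (m + 1) * (betaMap β)^[h + 1 + u] y := h2
      _ ≤ β ^ (m + 1) * (β ^ (h + 1) * ((betaMap β)^[u] y - (betaMap β)^[v] y)) := by gcongr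
      _ = β ^ (m + 1 + (h + 1)) * ((betaMap β)^[u] y - (betaMap β)^[v] y) := by ring
      _ ≤ β ^ (m + 1 + (h + 1)) * |(betaMap β)^[u] y - (betaMap β)^[v] y| := by
        gcongr; exact le_abs_self _
      _ ≤ _ := by gcongr; exact hβ.le
  rcases lt_or_gt_of_ne hne with hgt | hgt
  · rw [abs_sub_comm]
    exact main r (r + s) (by omega) (fun i hi => (hlt i hi).symm) hgt
  · exact main (r + s) r le_rfl hlt hgt

open Polynomial in
theorem exists_lower_bound_of_automatic {β ξ y : ℝ} (hint : IsIntegral ℤ β) (hβ : 1 < β)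
    (hconj : ∀ z : ℂ, aeval z (minpoly ℚ β) = 0 → z ≠ (β : ℂ) → ‖z‖ ≤ 1)
    (hy : y ∈ Set.Ico (0 : ℝ) 1) {A B D : ℤ[X]} (hA : aeval β A ≠ 0) (hD : aeval β D ≠ 0)
    (hyξ : aeval β D * y = aeval β A * ξ + aeval β B) {a : ℕ → ℤ} (ha : IsAutomatic a)
    (hay : ∀ n, a (n + 1) = betaDigits β y n)
    (hinj : Function.Injective fun n => (betaMap β)^[n] y) :
    ∃ (c : ℝ) (E : ℕ), 0 < c ∧ ∀ P Q : ℤ, 1 ≤ Q → |(P : ℝ)| ≤ (|ξ| + 1) * Q →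
      c ≤ |Q * ξ - P| * (Q : ℝ) ^ E := by
  obtain ⟨k, t, C, hk, hrep⟩ := exists_repetition_bounds hβ hy ha hay hinj
  obtain ⟨d, hd⟩ := one_le_abs_aeval_mul_pow hint
  obtain ⟨KA, hKA, hA'⟩ := exists_norm_aeval_le A
  obtain ⟨KB, hKB, hB'⟩ := exists_norm_aeval_le B
  obtain ⟨KD, hKD, hD'⟩ := exists_norm_aeval_le D
  set K : ℝ := KD * (2 * t * β) + (KA * (|ξ| + 1) + KB) * 2 + 1 with hK
  have hK1 : 1 ≤ K := by
    have : 0 ≤ KD * (2 * t * β) + (KA * (|ξ| + 1) + KB) * 2 := by positivity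
    linarith
  obtain ⟨C₂, E, hC₂, hscale⟩ :=
    -- Chosen so that |Q D(β) θ| M^d ≤ 1/2 for M = KQℓ; the extra power of Q is the coefficient of
    -- θ.
    exists_scale hβ hk (2 * |aeval β D| * K ^ d) (by positivity) d (d + 1)
  have hApos := abs_pos.2 hA
  have hDpos := abs_pos.2 hD
  refine ⟨|aeval β D| / (|aeval β A| * C₂ ^ (t + C + 1)), E * (t + C + 1), by positivity,
    fun P Q hQ hP => ?_⟩
  have hQ1 : (1 : ℝ) ≤ Q := by exact_mod_cast hQ
  obtain ⟨n, hn1, hn2⟩ := hscale Q hQ1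
  obtain ⟨r, s, hrs, hup, hlow⟩ := hrep n
  set ℓ := k ^ n with hℓ
  have hℓ1 : (1 : ℝ) ≤ (ℓ : ℝ) := by exact_mod_cast Nat.one_le_pow _ _ (by omega)
  set θ := (betaMap β)^[r + s] y - (betaMap β)^[r] y with hθ
  set M : ℝ := K * Q * ℓ with hM
  have hM1 : 1 ≤ M :=
    one_le_mul_of_one_le_of_one_le (one_le_mul_of_one_le_of_one_le hK1 hQ1) hℓ1
  set p := hornerPoly (betaDigits β y)
  set G : ℤ[X] := D * Polynomial.C Q * (p (r + s) - p r) -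
    (A * Polynomial.C P + B * Polynomial.C Q) * (X ^ (r + s) - X ^ r) with hG
  have hdig : ∀ n, |(betaDigits β y n : ℝ)| ≤ β := fun n => by
    rw [abs_of_nonneg (by exact_mod_cast betaDigits_nonneg hβ hy n)]
    exact betaDigits_le hβ hy n
  have hrs' : (r : ℝ) + s ≤ t * ℓ := by exact_mod_cast hrs
  have hGz : ∀ z : ℂ, aeval z (minpoly ℚ β) = 0 → z ≠ (β : ℂ) → ‖aeval z G‖ ≤ M := by
    intro z hz hne
    have hz1 := hconj z hz hne
    have hp : ‖aeval z (p (r + s)) - aeval z (p r)‖ ≤ 2 * (t * ℓ) * β := by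
      have h1 := norm_aeval_hornerPoly_le hdig hz1 (r + s)
      have h2 := norm_aeval_hornerPoly_le hdig hz1 r
      refine (norm_sub_le _ _).trans ((add_le_add h1 h2).trans ?_)
      push_cast
      have : (0 : ℝ) ≤ s := Nat.cast_nonneg s
      rw [← add_mul]
      gcongr
      linarith
    have hX : ‖z ^ (r + s) - z ^ r‖ ≤ 2 := by
      refine (norm_sub_le _ _).trans ?_
      rw [norm_pow, norm_pow]
      linarith [pow_le_one₀ (norm_nonneg z) hz1 (n := r + s), pow_le_one₀ (norm_nonneg z) hz1 (n := r)]
    have hQn : ‖(Q : ℂ)‖ = Q := by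
      rw [Complex.norm_intCast, abs_of_nonneg (by linarith)]
    have hPn : ‖(P : ℂ)‖ ≤ (|ξ| + 1) * Q := by rwa [Complex.norm_intCast]
    have hGe : aeval z G = aeval z D * Q * (aeval z (p (r + s)) - aeval z (p r)) -
        (aeval z A * P + aeval z B * Q) * (z ^ (r + s) - z ^ r) := by
      simp [hG]
    rw [hGe]
    calc _ ≤ KD * Q * (2 * (t * ℓ) * β) + (KA * ((|ξ| + 1) * Q) + KB * Q) * 2 := by
          refine (norm_sub_le _ _).trans (add_le_add ?_ ?_)
          · rw [norm_mul, norm_mul, hQn]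
            gcongr
            exact hD' z hz1
          · rw [norm_mul]
            refine mul_le_mul ((norm_add_le _ _).trans ?_) hX (norm_nonneg _) (by positivity)
            rw [norm_mul, norm_mul, hQn]
            gcongr
            · exact hA' z hz1
            · exact hB' z hz1
      _ = KD * (2 * t * β) * Q * ℓ + (KA * (|ξ| + 1) + KB) * 2 * Q * 1 := by ring
      _ ≤ KD * (2 * t * β) * Q * ℓ + (KA * (|ξ| + 1) + KB) * 2 * Q * ℓ := by gcongr
      _ ≤ M := by
        rw [hM, hK]
        nlinarith [mul_nonneg (zero_le_one.trans hQ1) (zero_le_one.trans hℓ1)]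
  have hGβ : aeval β G = aeval β A * (β ^ (r + s) - β ^ r) * (Q * ξ - P) - Q * aeval β D * θ := by
    have h1 := pow_mul_eq_aeval_hornerPoly (β := β) y (r + s)
    have h2 := pow_mul_eq_aeval_hornerPoly (β := β) y r
    have hGe : aeval β G = aeval β D * Q * (aeval β (p (r + s)) - aeval β (p r)) -
        (aeval β A * P + aeval β B * Q) * (β ^ (r + s) - β ^ r) := by
      simp [hG]
    rw [hGe, hθ]
    linear_combination (-aeval β D * Q) * h1 + (aeval β D * Q) * h2 +
      (Q * (β ^ (r + s) - β ^ r)) * hyξ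
  set δ := |Q * ξ - P| with hδ
  have hΔ : |β ^ (r + s) - β ^ r| ≤ β ^ (t * ℓ) := by
    have h1 : β ^ r ≤ β ^ (r + s) := pow_le_pow_right₀ hβ.le (by omega)
    have h2 : β ^ (r + s) ≤ β ^ (t * ℓ) := pow_le_pow_right₀ hβ.le hrs
    have h3 : 0 ≤ β ^ r := by positivity
    rw [abs_of_nonneg (by linarith)]
    linarith
  have hW : |aeval β A * (β ^ (r + s) - β ^ r) * (Q * ξ - P)| ≤ |aeval β A| * β ^ (t * ℓ) * δ := by
    rw [abs_mul, abs_mul]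
    gcongr
  set W := aeval β A * (β ^ (r + s) - β ^ r) * (Q * ξ - P)
  have hQDθ : |Q * aeval β D * θ| = Q * |aeval β D| * |θ| := by
    rw [abs_mul, abs_mul, abs_of_nonneg (zero_le_one.trans hQ1)]
  have hβℓ : 0 < β ^ ℓ := by positivity
  have hβℓ1 : 1 ≤ β ^ ℓ := one_le_pow₀ hβ.le
  have hkey : |aeval β D| ≤ |W| * (β ^ ℓ) ^ (C + 1) := by
    -- If G(β) = 0, the lower bound for θ passes to W; otherwise the θ term is at most half of the
    -- Liouville bound, and W carries the rest.
    by_cases h0 : aeval β G = 0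
    · have hWe : |W| = Q * |aeval β D| * |θ| := by
        rw [← hQDθ, sub_eq_zero.1 (hGβ.symm.trans h0)]
      have h1 : (1 : ℝ) ≤ (β ^ ℓ) ^ (C + 1) * |θ| := by
        refine hlow.trans ?_
        rw [mul_comm C, pow_mul]
        gcongr
        omega
      calc |aeval β D| ≤ |aeval β D| * (Q * ((β ^ ℓ) ^ (C + 1) * |θ|)) :=
            le_mul_of_one_le_right hDpos.le (one_le_mul_of_one_le_of_one_le hQ1 h1)
        _ = _ := by rw [hWe]; ring
    · have h1 := hd G M hM1 h0 hGz
      have h2 : |aeval β G| ≤ |W| + Q * |aeval β D| * |θ| := by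
        rw [hGβ, ← hQDθ]
        exact abs_sub _ _
      have hMd : 0 ≤ M ^ d := by positivity
      have h3 : 2 * |aeval β D| * Q * M ^ d ≤ β ^ ℓ := by
        refine le_of_eq_of_le ?_ hn1
        rw [hM, mul_pow, mul_pow]
        ring
      have h4 : 2 * (Q * |aeval β D| * |θ| * M ^ d) ≤ 1 := by
        calc _ = (2 * |aeval β D| * Q * M ^ d) * |θ| := by ring
          _ ≤ β ^ ℓ * |θ| := by gcongr
          _ ≤ 1 := hup
      have h5 : 1 ≤ 2 * (|W| * M ^ d) := by
        have := mul_le_mul_of_nonneg_right h2 hMd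
        rw [add_mul] at this
        linarith
      calc |aeval β D| ≤ |aeval β D| * (Q * (2 * (|W| * M ^ d))) :=
            le_mul_of_one_le_right hDpos.le (one_le_mul_of_one_le_of_one_le hQ1 h5)
        _ = |W| * (2 * |aeval β D| * Q * M ^ d) := by ring
        _ ≤ |W| * β ^ ℓ := by gcongr
        _ ≤ |W| * (β ^ ℓ) ^ (C + 1) := by
          gcongr
          exact le_self_pow₀ hβℓ1 (by omega)
  rw [div_le_iff₀ (by positivity)]
  have hδ0 : 0 ≤ δ := abs_nonneg _
  calc |aeval β D| ≤ |W| * (β ^ ℓ) ^ (C + 1) := hkey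
    _ ≤ |aeval β A| * β ^ (t * ℓ) * δ * (β ^ ℓ) ^ (C + 1) := by gcongr
    _ = |aeval β A| * δ * (β ^ ℓ) ^ (t + C + 1) := by
      rw [mul_comm t, pow_mul]; ring
    _ ≤ |aeval β A| * δ * (C₂ * Q ^ E) ^ (t + C + 1) := by gcongr
    _ = _ := by rw [mul_pow, ← pow_mul]; ring

-- A coincidence in the orbit would put y, hence ξ, in ℚ(β).
open Polynomial in
theorem betaMap_iterate_injective_of_transcendental {β ξ y : ℝ} (hint : IsIntegral ℤ β)
    (hβ : 1 < β) (hξ : Transcendental ℤ ξ) {A B D : ℤ[X]} (hA : aeval β A ≠ 0)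
    (hyξ : aeval β D * y = aeval β A * ξ + aeval β B) :
    Function.Injective fun n => (betaMap β)^[n] y := by
  intro m n hmn
  by_contra hne
  have hpoly : ∀ F : ℤ[X], IsAlgebraic ℤ (aeval β F) := fun F => by
    rw [aeval_eq_sum_range]
    exact (IsIntegral.sum _ fun i _ => (hint.pow i).smul _).isAlgebraic
  have hpow : β ^ m - β ^ n ≠ 0 := by
    rw [sub_ne_zero]
    exact fun h => hne (pow_right_injective₀ (by linarith) hβ.ne' h)
  have h1 := pow_mul_eq_aeval_hornerPoly (β := β) y m
  have h2 := pow_mul_eq_aeval_hornerPoly (β := β) y n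
  have h3 : (betaMap β)^[m] y = (betaMap β)^[n] y := hmn
  refine hξ ?_
  set p := hornerPoly (betaDigits β y)
  have hξe : ξ = aeval β (D * (p m - p n) - B * (X ^ m - X ^ n)) *
      (aeval β (A * (X ^ m - X ^ n)))⁻¹ := by
    rw [eq_mul_inv_iff_mul_eq₀ (by simpa using ⟨hA, hpow⟩)]
    simp only [map_sub, map_mul, map_pow, aeval_X]
    linear_combination aeval β D * (h1 - h2 + h3) - (β ^ m - β ^ n) * hyξ
  rw [hξe]
  exact (hpoly _).mul (hpoly _).inv

open Polynomial in
theorem not_isAutomatic_of_liouville {β ξ y : ℝ} (hint : IsIntegral ℤ β) (hβ : 1 < β)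
    (hconj : ∀ z : ℂ, aeval z (minpoly ℚ β) = 0 → z ≠ (β : ℂ) → ‖z‖ ≤ 1) (hξ : Liouville ξ)
    (hy : y ∈ Set.Ico (0 : ℝ) 1) {A B D : ℤ[X]} (hA : aeval β A ≠ 0) (hD : aeval β D ≠ 0)
    (hyξ : aeval β D * y = aeval β A * ξ + aeval β B) {a : ℕ → ℤ}
    (hay : ∀ n, a (n + 1) = betaDigits β y n) : ¬ IsAutomatic a := by
  intro ha
  obtain ⟨c, E, hc, hlow⟩ := exists_lower_bound_of_automatic hint hβ hconj hy hA hD hyξ ha hay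
    (betaMap_iterate_injective_of_transcendental hint hβ hξ.transcendental hA hyξ)
  obtain ⟨N, hN⟩ := pow_unbounded_of_one_lt (1 / c) one_lt_two
  rw [div_lt_iff₀ hc] at hN
  obtain ⟨P, Q, hQ, -, hPQ⟩ := hξ (N + E + 1)
  have hQ2 : (2 : ℝ) ≤ Q := by exact_mod_cast hQ
  have hQ0 : (0 : ℝ) < Q := by linarith
  have hP : |(P : ℝ)| ≤ (|ξ| + 1) * Q := by
    have h1 : |ξ - P / Q| ≤ 1 :=
      hPQ.le.trans (div_le_one_of_le₀ (one_le_pow₀ (by linarith)) (by positivity))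
    have h2 : |(P : ℝ) / Q| ≤ |ξ| + 1 := by
      have := abs_sub_abs_le_abs_sub ((P : ℝ) / Q) ξ
      rw [abs_sub_comm] at this
      linarith
    rwa [abs_div, abs_of_pos hQ0, div_le_iff₀ hQ0] at h2
  have h3 := hlow P Q hQ.le hP
  have h4 : |Q * ξ - P| = Q * |ξ - P / Q| := by
    rw [← abs_of_pos hQ0, ← abs_mul, abs_of_pos hQ0, mul_sub, mul_div_cancel₀ _ hQ0.ne']
  rw [lt_div_iff₀ (by positivity)] at hPQ
  have h5 : |Q * ξ - P| * (Q : ℝ) ^ E * Q ^ N < 1 := by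
    rw [h4]
    calc _ = |ξ - P / Q| * (Q : ℝ) ^ (N + E + 1) := by ring
      _ < 1 := hPQ
  have h6 : (2 : ℝ) ^ N * c ≤ |Q * ξ - P| * (Q : ℝ) ^ E * Q ^ N := by
    rw [mul_comm]
    gcongr
  linarith

theorem theorem6 (β : ℝ) (hβ : IsPisot β ∨ IsSalem β) (ξ : ℝ) (hξ : Liouville ξ) :
    ¬ IsAutomatic (renyiExpansion β ξ) ∧
      ∀ m : ℕ, 0 ≤ ξ → ξ < β ^ m → ¬ IsAutomatic (betaDigits β (ξ / β ^ m)) := by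
  obtain ⟨hint, hβ1, hconj⟩ : IsIntegral ℤ β ∧ 1 < β ∧
      ∀ z : ℂ, Polynomial.aeval z (minpoly ℚ β) = 0 → z ≠ (β : ℂ) → ‖z‖ ≤ 1 := by
    rcases hβ with ⟨h1, h2, h3⟩ | ⟨h1, h2, h3, -⟩
    · exact ⟨h1, h2, fun z hz hne => (h3 z hz hne).le⟩
    · exact ⟨h1, h2, h3⟩
  have hβ0 : β ≠ 0 := by linarith
  constructor
  · exact not_isAutomatic_of_liouville hint hβ1 hconj hξ (y := Int.fract ξ)
      ⟨Int.fract_nonneg _, Int.fract_lt_one _⟩ (A := 1) (B := -Polynomial.C ⌊ξ⌋) (D := 1)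
      (by simp) (by simp) (by simp [Int.fract, sub_eq_add_neg]) fun n => rfl
  · intro m h0 hm
    have hy : ξ / β ^ m ∈ Set.Ico (0 : ℝ) 1 :=
      ⟨by positivity, (div_lt_one (by positivity)).2 hm⟩
    -- The index shift makes y = T(ξ/β^m), and β^m y = βξ - d β^m with d the digit of index 0.
    refine not_isAutomatic_of_liouville hint hβ1 hconj hξ (betaMap_iterate_mem (β := β) hy 1)
      (A := Polynomial.X) (B := -Polynomial.C (betaDigits β (ξ / β ^ m) 0) * Polynomial.X ^ m)
      (D := Polynomial.X ^ m) (by simpa using hβ0) (by simp [hβ0]) ?_ fun n => ?_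
    · have h := beta_mul_iterate (β := β) (ξ / β ^ m) 0
      have hd : β ^ m * (ξ / β ^ m) = ξ := mul_div_cancel₀ _ (by positivity)
      simp only [Function.iterate_zero, id, zero_add] at h
      simp only [map_mul, map_neg, map_pow, Polynomial.aeval_X, eq_intCast, map_intCast]
      linear_combination (-β ^ m) * h + β * hd
    · rw [betaDigits_add, add_comm]
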